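/- Let $f:\mathbb R^n\to\mathbb R^n$ be a smooth ($C^\infty$) vector field and let $\varphi$ be the local flow of $x'=f(x)$. Let $x_0$ be a periodic point with minimal period $T>0$, i.e. $T$ is the least positive time with $\varphi(T,x_0)=x_0$, and assume that $\lambda=1$ is an eigenvalue of $M:=D_x\varphi(T,x_0)$ of (algebraic) multiplicity one. Let $\Pi=\{x\in\mathbb R^n : \alpha(x)=0\}$ be a local Poincaré section through $x_0$: $\alpha:\mathbb R^n\to\mathbb R$ is smooth, $0$ is a regular value of $\alpha$, $\alpha(x_0)=0$, and $D\alpha(x_0)f(x_0)\neq 0$. Call a real function $t_\Pi$ a return time of the local section near $x_0$ if it is continuous at $x_0$, satisfies $\alpha(\varphi(t_\Pi(x),x))=0$ for all $x$ in a neighbourhood of $x_0$ in $\mathbb R^n$, and on the section is the first return time, i.e. for every sufficiently small $r>0$ and all $x\in\Pi$ sufficiently close to $x_0$ (depending on $r$), $t_\Pi(x)$ is the least $t>0$ with $\varphi(t,x)\in\Pi\cap B(x_0,r)$. Then such a function $t_\Pi$ exists, and every such function satisfies $t_\Pi(x_0)=T$, is differentiable at $x_0$, and $$\ker Dt_\Pi(x_0)=T_{x_0}\Pi\iff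 D\alpha(x_0)\text{ is a left eigenvector of }M\text{ for the eigenvalue }1,$$ where $T_{x_0}\Pi$ is the set of velocities at $x_0$ of smooth curves in $\Pi$ through $x_0$. In that case, $t_\Pi(x)=t_\Pi(x_0)+O(\|x-x_0\|^2)$ as $x\to x_0$, $x\in\Pi$. -/

import Mathlib

open Filter Topology Asymptotics Set
open scoped ContDiff

/-- The domain of the local flow of the autonomous equation `x' = f x`: the pairs `(t, x)` such that
the solution starting at `x` exists on the whole time interval between `0` and `t`. -/
def flowDomain {E : Type*} [NormedAddCommGroup E] [NormedSpace ℝ E] (f : E → E) : Set (ℝ × E) :=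
  {p | ∃ γ : ℝ → E, γ 0 = p.2 ∧ IsIntegralCurveOn γ (fun _ => f) (uIcc 0 p.1)}

open Classical in
/-- The local flow `φ(t, x)` induced by the vector field `f`: the value at time `t` of the solution
of `x' = f x` that starts at `x`. Outside `flowDomain f` the value is a dummy one. -/
noncomputable def localFlow {E : Type*} [NormedAddCommGroup E] [NormedSpace ℝ E]
    (f : E → E) (t : ℝ) (x : E) : E :=
  if h : (t, x) ∈ flowDomain f then Classical.choose h t else x

/-- For a `C¹` vector field solutions are unique, so the value of the local flow is that of any
solution. -/
theorem localFlow_eq {E : Type*} [NormedAddCommGroup E] [NormedSpace ℝ E] {f : E → E}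
    (hf : ContDiff ℝ 1 f) {γ : ℝ → E} {t : ℝ}
    (hγ : IsIntegralCurveOn γ (fun _ => f) (uIcc 0 t)) :
    localFlow f t (γ 0) = γ t := by
  have h : (t, γ 0) ∈ flowDomain f := ⟨γ, rfl, hγ⟩
  rw [localFlow, dif_pos h]
  obtain ⟨h0, hδ⟩ := Classical.choose_spec h
  set δ : ℝ → E := Classical.choose h
  have hcγ := hγ.continuousOn
  have hcδ := hδ.continuousOn
  set K : Set E := γ '' uIcc 0 t ∪ δ '' uIcc 0 t with hK
  have hKc : IsCompact K := (isCompact_uIcc.image_of_continuousOn hcγ).union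
    (isCompact_uIcc.image_of_continuousOn hcδ)
  obtain ⟨L, hL⟩ := (hf.locallyLipschitz.locallyLipschitzOn
    (s := K)).exists_lipschitzOnWith_of_compact hKc
  have mγ : ∀ s ∈ uIcc 0 t, γ s ∈ K := fun s hs => Or.inl ⟨s, hs, rfl⟩
  have mδ : ∀ s ∈ uIcc 0 t, δ s ∈ K := fun s hs => Or.inr ⟨s, hs, rfl⟩
  rcases le_total 0 t with ht | ht
  · rw [uIcc_of_le ht] at *
    refine ODE_solution_unique_of_mem_Icc_right (v := fun _ => f) (s := fun _ => K) (K := L)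
      (fun _ _ => hL) hcδ (fun s hs => ?_) (fun s hs => mδ s ⟨hs.1, hs.2.le⟩) hcγ
      (fun s hs => ?_) (fun s hs => mγ s ⟨hs.1, hs.2.le⟩) h0 (right_mem_Icc.2 ht)
    · exact (hδ s ⟨hs.1, hs.2.le⟩).mono_of_mem_nhdsWithin (Icc_mem_nhdsGE_of_mem hs)
    · exact (hγ s ⟨hs.1, hs.2.le⟩).mono_of_mem_nhdsWithin (Icc_mem_nhdsGE_of_mem hs)
  · rw [uIcc_of_ge ht] at *
    refine ODE_solution_unique_of_mem_Icc_left (v := fun _ => f) (s := fun _ => K) (K := L)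
      (fun _ _ => hL) hcδ (fun s hs => ?_) (fun s hs => mδ s ⟨hs.1.le, hs.2⟩) hcγ
      (fun s hs => ?_) (fun s hs => mγ s ⟨hs.1.le, hs.2⟩) h0 (left_mem_Icc.2 ht)
    · exact (hδ s ⟨hs.1.le, hs.2⟩).mono_of_mem_nhdsWithin (Icc_mem_nhdsLE_of_mem hs)
    · exact (hγ s ⟨hs.1.le, hs.2⟩).mono_of_mem_nhdsWithin (Icc_mem_nhdsLE_of_mem hs)

/-- `x₀` is a periodic point of the local flow of `f` with minimal period `T > 0`. -/
def IsPeriodicPointWithMinimalPeriod {E : Type*} [NormedAddCommGroup E] [NormedSpace ℝ E]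
    (f : E → E) (x₀ : E) (T : ℝ) : Prop :=
  IsLeast {t : ℝ | 0 < t ∧ (t, x₀) ∈ flowDomain f ∧ localFlow f t x₀ = x₀} T

/-- The monodromy operator `M = D_x φ(T, x₀)`. -/
noncomputable def monodromy {E : Type*} [NormedAddCommGroup E] [NormedSpace ℝ E]
    (f : E → E) (x₀ : E) (T : ℝ) : E →L[ℝ] E :=
  fderiv ℝ (fun x => localFlow f T x) x₀

/-- `μ` is an eigenvalue of `M` of (algebraic) multiplicity one: a simple root of the
characteristic polynomial. -/
def IsSimpleEigenvalue {E : Type*} [NormedAddCommGroup E] [NormedSpace ℝ E]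
    [FiniteDimensional ℝ E] (M : E →L[ℝ] E) (μ : ℝ) : Prop :=
  (LinearMap.charpoly (M : E →ₗ[ℝ] E)).rootMultiplicity μ = 1

/-- The covector `w` is a left eigenvector of `M` for the eigenvalue `μ`: `w ≠ 0`, `w M = μ w`. -/
def IsLeftEigenvector {E : Type*} [NormedAddCommGroup E] [NormedSpace ℝ E]
    (M : E →L[ℝ] E) (μ : ℝ) (w : E →L[ℝ] ℝ) : Prop :=
  w ≠ 0 ∧ w.comp M = μ • w

/-- The zero level set `Π = {α = 0}`. -/
def levelSet {E : Type*} (α : E → ℝ) : Set E := {x | α x = 0}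

/-- `Π = {α = 0}` is a local Poincaré section through `x₀` for the vector field `f`: `α` is smooth,
`0` is a regular value of `α`, `x₀ ∈ Π`, and `f` is transversal to `Π` at `x₀` (hence near `x₀`). -/
structure IsLocalPoincareSection {E : Type*} [NormedAddCommGroup E] [NormedSpace ℝ E]
    (f : E → E) (α : E → ℝ) (x₀ : E) : Prop where
  smooth : ContDiff ℝ ∞ α
  regular : ∀ x ∈ levelSet α, Function.Surjective (fderiv ℝ α x)
  mem : x₀ ∈ levelSet α
  transversal : fderiv ℝ α x₀ (f x₀) ≠ 0

/-- The tangent space at `x₀` of a subset `S`: the velocities at `x₀` of the smooth curves that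
lie in `S` and pass through `x₀`. -/
def tangentVectors {E : Type*} [NormedAddCommGroup E] [NormedSpace ℝ E] (S : Set E) (x₀ : E) :
    Set E :=
  {v | ∃ γ : ℝ → E, γ 0 = x₀ ∧ (∀ᶠ s in 𝓝 0, γ s ∈ S) ∧ ContDiffAt ℝ ∞ γ 0 ∧ deriv γ 0 = v}

/-- `τ` is (a representative of the germ at `x₀` of) the return time function `t_Π` of the local
section `Π = {α = 0}` through `x₀`. It is defined on a neighbourhood of `x₀` in the whole space:
the orbit of `x` is in `Π` at time `τ x`, and `τ` is continuous at `x₀`. On the section itself it is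
the first return time: for every small radius `r` and all `x ∈ Π` close to `x₀`, `τ x` is the least
positive time at which the orbit of `x` hits the piece of `Π` in the ball of radius `r` about
`x₀`. -/
structure IsReturnTime {E : Type*} [NormedAddCommGroup E] [NormedSpace ℝ E]
    (f : E → E) (α : E → ℝ) (x₀ : E) (τ : E → ℝ) : Prop where
  continuousAt : ContinuousAt τ x₀
  mem_section : ∀ᶠ x in 𝓝 x₀, (τ x, x) ∈ flowDomain f ∧ localFlow f (τ x) x ∈ levelSet α
  first_return : ∀ᶠ r in 𝓝[>] (0 : ℝ), ∀ᶠ x in 𝓝[levelSet α] x₀,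
    IsLeast {t : ℝ | 0 < t ∧ (t, x) ∈ flowDomain f ∧
      localFlow f t x ∈ levelSet α ∩ Metric.ball x₀ r} (τ x)

/-!
The flow `φ` of `f` has, at the point `(T, x₀)` of a periodic orbit, a second-order expansion
`φ(t, x) = x₀ + (t - T) f(x₀) + M (x - x₀) + O(‖x - x₀‖² + |t - T|²)`
with `M f(x₀) = f(x₀)` (`exists_localFlow_expansion`). Only this expansion along one orbit is
needed, not the smoothness of `φ` on its whole domain. It is obtained by cutting `f` off outside a
large ball, which makes `f` and its derivative globally Lipschitz; then Grönwall's inequality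
compares a solution with the one through `x₀` corrected by the fundamental solution of the
variational equation (`norm_sub_sub_fundamental_solution_le`), and `f` itself is transported along
the orbit by the fundamental solution (`fundamental_solution_apply_eq`). In particular `M` is the
monodromy operator.

Write `a = Dα(x₀)` and `c = a f(x₀) ≠ 0`. Inserting the expansion into `α(φ(τ(x), x)) = 0`, with
`τ` continuous at `x₀` and `τ(x₀) = T`, gives
`c (τ(x) - T) + a M (x - x₀) = O(‖x - x₀‖²)` (`isBigO_sq_of_isBigO_sq_add_sq`).
So `τ` is differentiable at `x₀` with `Dτ(x₀) = -c⁻¹ a M`, and the kernel of `Dτ(x₀)` is that of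
`a M`. The tangent space of the section is the kernel of `a` (`tangentVectors_levelSet`). As
`M f(x₀) = f(x₀)` and `a f(x₀) ≠ 0`, the two kernels agree exactly when `a M = a`
(`ker_comp_eq_ker_iff`); in that case `a M (x - x₀) = a (x - x₀) = O(‖x - x₀‖²)` on the section,
hence so is `τ(x) - T`.

A return time exists (`exists_isReturnTime`) because `α` is strictly monotone along nearby orbits
for times close to `0` and to `T`: there is exactly one crossing close to `T`, no crossing shortly
after time `0`, and at the times in between the orbit keeps away from `x₀`, by minimality of `T`.
-/

open scoped NNReal

/-! ### Quadratic remainders -/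

theorem norm_sub_sub_fderiv_le_of_lipschitzOnWith {E F : Type*} [NormedAddCommGroup E]
    [NormedSpace ℝ E] [NormedAddCommGroup F] [NormedSpace ℝ F] {g : E → F} {K : ℝ≥0} {s : Set E}
    (hs : Convex ℝ s) (hd : ∀ x ∈ s, DifferentiableAt ℝ g x)
    (hL : LipschitzOnWith K (fderiv ℝ g) s) {y z : E} (hy : y ∈ s) (hz : z ∈ s) :
    ‖g y - g z - fderiv ℝ g z (y - z)‖ ≤ K * ‖y - z‖ ^ 2 := by
  have hsub : segment ℝ z y ⊆ s := hs.segment_subset hz hy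
  have := (convex_segment z y).norm_image_sub_le_of_norm_hasFDerivWithin_le' (f := g)
    (f' := fderiv ℝ g) (φ := fderiv ℝ g z) (C := K * ‖y - z‖)
    (fun w hw => (hd w (hsub hw)).hasFDerivAt.hasFDerivWithinAt)
    (fun w hw => by
      refine (hL.norm_sub_le (hsub hw) hz).trans ?_
      gcongr
      have := norm_sub_le_of_mem_segment hw
      simpa using this)
    (left_mem_segment ℝ z y) (right_mem_segment ℝ z y)
  calc _ ≤ _ := this
    _ = _ := by ring

theorem isBigO_sub_sub_fderiv {E F : Type*} [NormedAddCommGroup E] [NormedSpace ℝ E]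
    [NormedAddCommGroup F] [NormedSpace ℝ F] {g : E → F} (hg : ContDiff ℝ 2 g) (x₀ : E) :
    (fun y => g y - g x₀ - fderiv ℝ g x₀ (y - x₀)) =O[𝓝 x₀] fun y => ‖y - x₀‖ ^ 2 := by
  obtain ⟨K, t, ht, hK⟩ :=
    (hg.fderiv_right (m := 1) (by norm_num)).contDiffAt.exists_lipschitzOnWith (x := x₀)
  obtain ⟨ε, hε, hball⟩ := Metric.mem_nhds_iff.1 ht
  refine IsBigO.of_bound K ?_
  filter_upwards [Metric.ball_mem_nhds x₀ hε] with y hy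
  rw [norm_pow, norm_norm]
  exact norm_sub_sub_fderiv_le_of_lipschitzOnWith (convex_ball x₀ ε)
    (fun x _ => hg.differentiable (by simp) x) (hK.mono hball) hy (Metric.mem_ball_self hε)

/-! ### Global solutions and the variational equation -/

/-- A bounded, globally Lipschitz field has solutions on the whole interval: a ball of radius `L S`
around the initial value cannot be left before time `S`, so the Picard-Lindelöf theorem applies. -/
theorem exists_isIntegralCurveOn_of_lipschitzWith_of_bounded {E : Type*} [NormedAddCommGroup E]
    [NormedSpace ℝ E] [CompleteSpace E] {v : ℝ → E → E} {K L : ℝ≥0} {S : ℝ} (hS : 0 ≤ S)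
    (hv : ∀ t ∈ Icc 0 S, LipschitzWith K (v t)) (hc : ∀ x, ContinuousOn (v · x) (Icc 0 S))
    (hb : ∀ t ∈ Icc 0 S, ∀ x, ‖v t x‖ ≤ L) (x : E) :
    ∃ γ : ℝ → E, γ 0 = x ∧ IsIntegralCurveOn γ v (Icc 0 S) := by
  have h : IsPicardLindelof v (⟨0, left_mem_Icc.2 hS⟩ : Icc 0 S) x (L * S.toNNReal) 0 L K :=
    { lipschitzOnWith := fun t ht => (hv t ht).lipschitzOnWith
      continuousOn := fun x _ => hc x
      norm_le := fun t ht x _ => hb t ht x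
      mul_max_le := by simp [hS] }
  exact h.exists_eq_forall_mem_Icc_hasDerivWithinAt₀

/-- The linear equation `Y' = A(t) Y`, `Y(0) = id` has a solution on the whole interval. The
operator `Y` is cut off by a bump function that equals `1` on the ball to which Grönwall's inequality
confines the solution; this makes the right-hand side bounded. -/
theorem exists_fundamental_solution {E : Type*} [NormedAddCommGroup E] [NormedSpace ℝ E]
    [FiniteDimensional ℝ E] {A : ℝ → E →L[ℝ] E} {S : ℝ} (hS : 0 ≤ S)
    (hA : ContinuousOn A (Icc 0 S)) :
    ∃ Y : ℝ → E →L[ℝ] E, Y 0 = ContinuousLinearMap.id ℝ E ∧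
      ∀ t ∈ Icc 0 S, HasDerivWithinAt Y ((A t).comp (Y t)) (Icc 0 S) t := by
  have := FiniteDimensional.complete ℝ E
  obtain ⟨a, ha⟩ := isCompact_Icc.exists_bound_of_continuousOn hA
  have ha0 : 0 ≤ a := (norm_nonneg _).trans (ha 0 (left_mem_Icc.2 hS))
  set R : ℝ := ‖ContinuousLinearMap.id ℝ E‖ * Real.exp (a * S) + 1 with hR
  have hR0 : 0 < R := by positivity
  let χ : ContDiffBump (0 : E →L[ℝ] E) := ⟨R, R + 1, hR0, by linarith⟩
  let F : (E →L[ℝ] E) → (E →L[ℝ] E) := fun Z => χ Z • Z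
  have hF : ContDiff ℝ 1 F := χ.contDiff.smul contDiff_id
  have hFs : HasCompactSupport F := χ.hasCompactSupport.smul_right
  obtain ⟨k, hk⟩ := hF.lipschitzWith_of_hasCompactSupport hFs (by simp)
  obtain ⟨b, hb⟩ := hFs.exists_bound_of_continuous hF.continuous
  have hb0 : 0 ≤ b := (norm_nonneg _).trans (hb 0)
  have hFle : ∀ Z, ‖F Z‖ ≤ ‖Z‖ := fun Z => by
    rw [norm_smul, Real.norm_of_nonneg χ.nonneg]
    exact mul_le_of_le_one_left (norm_nonneg _) χ.le_one
  obtain ⟨Y, hY0, hY⟩ := exists_isIntegralCurveOn_of_lipschitzWith_of_bounded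
    (v := fun t Z => (A t).comp (F Z)) (K := a.toNNReal * k) (L := a.toNNReal * b.toNNReal) hS
    (fun t ht => LipschitzWith.of_dist_le_mul fun Z W => by
      rw [dist_eq_norm, dist_eq_norm, ← ContinuousLinearMap.comp_sub]
      refine (ContinuousLinearMap.opNorm_comp_le _ _).trans ?_
      rw [NNReal.coe_mul, Real.coe_toNNReal _ ha0, mul_assoc]
      exact mul_le_mul (ha t ht) (hk.norm_sub_le Z W) (norm_nonneg _) ha0)
    (fun Z => hA.clm_comp continuousOn_const)
    (fun t ht Z => by
      refine (ContinuousLinearMap.opNorm_comp_le _ _).trans ?_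
      rw [NNReal.coe_mul, Real.coe_toNNReal _ ha0, Real.coe_toNNReal _ hb0]
      exact mul_le_mul (ha t ht) (hb Z) (norm_nonneg _) ha0)
    (ContinuousLinearMap.id ℝ E)
  have hbd : ∀ t ∈ Icc 0 S, ‖Y t‖ ≤ R := fun t ht => by
    have := norm_le_gronwallBound_of_norm_deriv_right_le (δ := ‖ContinuousLinearMap.id ℝ E‖)
      (K := a) (ε := 0) hY.continuousOn
      (fun s hs => (hY s ⟨hs.1, hs.2.le⟩).mono_of_mem_nhdsWithin (Icc_mem_nhdsGE_of_mem hs))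
      (by rw [hY0]) (fun s hs => by
        rw [add_zero]
        refine (ContinuousLinearMap.opNorm_comp_le _ _).trans ?_
        exact mul_le_mul (ha s ⟨hs.1, hs.2.le⟩) (hFle _) (norm_nonneg _) ha0) t ht
    rw [gronwallBound_ε0, sub_zero] at this
    refine this.trans ?_
    have h2 : Real.exp (a * t) ≤ Real.exp (a * S) := by gcongr; exact ht.2
    have := mul_le_mul_of_nonneg_left h2 (norm_nonneg (ContinuousLinearMap.id ℝ E))
    linarith
  refine ⟨Y, hY0, fun t ht => ?_⟩
  have h1 : F (Y t) = Y t := by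
    have : χ (Y t) = 1 := χ.one_of_mem_closedBall (by simpa using hbd t ht)
    simp only [F, this, one_smul]
  have := hY t ht
  simp only [h1] at this
  exact this

/-- If `Y` is the fundamental solution of the variational equation along the solution `γ`, then a
solution `δ` is `γ + Y (δ(0) - γ(0))` up to an error quadratic in `δ(0) - γ(0)`. The constant
depends only on the Lipschitz constants of `g` and of its derivative and on the length of the interval. -/
theorem norm_sub_sub_fundamental_solution_le {E : Type*} [NormedAddCommGroup E] [NormedSpace ℝ E]
    {g : E → E} {K K' : ℝ≥0} {S : ℝ} (hg : LipschitzWith K g) (hd : Differentiable ℝ g)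
    (hg' : LipschitzWith K' (fderiv ℝ g)) {γ δ : ℝ → E}
    (hγ : IsIntegralCurveOn γ (fun _ => g) (Icc 0 S))
    (hδ : IsIntegralCurveOn δ (fun _ => g) (Icc 0 S)) {Y : ℝ → E →L[ℝ] E}
    (hY0 : Y 0 = ContinuousLinearMap.id ℝ E)
    (hY : ∀ t ∈ Icc 0 S, HasDerivWithinAt Y ((fderiv ℝ g (γ t)).comp (Y t)) (Icc 0 S) t) :
    ∀ t ∈ Icc 0 S, ‖δ t - γ t - Y t (δ 0 - γ 0)‖ ≤
      gronwallBound 0 K (K' * Real.exp (K * S) ^ 2) S * ‖δ 0 - γ 0‖ ^ 2 := by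
  intro t ht
  set v := δ 0 - γ 0 with hv
  have right : ∀ {F : Type _} [NormedAddCommGroup F] [NormedSpace ℝ F] {h : ℝ → F} {h' : F}
      {s : ℝ}, s ∈ Ico 0 S → HasDerivWithinAt h h' (Icc 0 S) s →
      HasDerivWithinAt h h' (Ici s) s := fun hs h =>
    h.mono_of_mem_nhdsWithin (Icc_mem_nhdsGE_of_mem hs)
  have hdist : ∀ s ∈ Ico 0 S, ‖δ s - γ s‖ ≤ ‖v‖ * Real.exp (K * S) := fun s hs => by
    have := dist_le_of_trajectories_ODE (v := fun _ => g) (fun _ => hg) hδ.continuousOn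
      (fun s hs => right hs (hδ s ⟨hs.1, hs.2.le⟩)) hγ.continuousOn
      (fun s hs => right hs (hγ s ⟨hs.1, hs.2.le⟩)) le_rfl s ⟨hs.1, hs.2.le⟩
    rw [dist_eq_norm, dist_eq_norm, sub_zero] at this
    refine this.trans ?_
    gcongr
    exact hs.2.le
  have hw : ∀ s ∈ Icc 0 S, HasDerivWithinAt (fun s => δ s - γ s - Y s v)
      (g (δ s) - g (γ s) - fderiv ℝ g (γ s) (Y s v)) (Icc 0 S) s := fun s hs =>
    ((hδ s hs).sub (hγ s hs)).sub
      ((hY s hs).clm_apply (hasDerivWithinAt_const s _ v) |>.congr_deriv (by simp))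
  have key := norm_le_gronwallBound_of_norm_deriv_right_le (δ := 0) (K := K)
    (ε := K' * Real.exp (K * S) ^ 2 * ‖v‖ ^ 2)
    (fun s hs => (hw s hs).continuousWithinAt) (fun s hs => right hs (hw s ⟨hs.1, hs.2.le⟩))
    (by simp [hY0, hv]) (fun s hs => by
      have e : g (δ s) - g (γ s) - fderiv ℝ g (γ s) (Y s v) =
          fderiv ℝ g (γ s) (δ s - γ s - Y s v) +
          (g (δ s) - g (γ s) - fderiv ℝ g (γ s) (δ s - γ s)) := by
        simp only [map_sub]; abel
      rw [e]
      refine (norm_add_le _ _).trans (add_le_add ?_ ?_)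
      · refine (ContinuousLinearMap.le_opNorm _ _).trans ?_
        gcongr
        exact norm_fderiv_le_of_lipschitz ℝ hg
      · refine (norm_sub_sub_fderiv_le_of_lipschitzOnWith convex_univ (fun x _ => hd x)
          hg'.lipschitzOnWith (mem_univ _) (mem_univ _)).trans ?_
        calc (K' : ℝ) * ‖δ s - γ s‖ ^ 2 ≤ K' * (‖v‖ * Real.exp (K * S)) ^ 2 := by
              gcongr; exact hdist s hs
          _ = _ := by ring) t ht
  refine key.trans ?_
  rw [sub_zero]
  refine (gronwallBound_mono le_rfl (by positivity) K.coe_nonneg ht.2).trans (le_of_eq ?_)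
  by_cases hK : (K : ℝ) = 0
  · simp only [hK, gronwallBound_K0]; ring
  · simp only [gronwallBound_of_K_ne_0 hK]; ring

/-- The velocity `g (γ t)` solves the variational equation along `γ`, so the fundamental solution
transports it. -/
theorem fundamental_solution_apply_eq {E : Type*} [NormedAddCommGroup E] [NormedSpace ℝ E]
    {g : E → E} {K : ℝ≥0} {S : ℝ} (hg : LipschitzWith K g) (hd : Differentiable ℝ g)
    {γ : ℝ → E} (hγ : IsIntegralCurveOn γ (fun _ => g) (Icc 0 S)) {Y : ℝ → E →L[ℝ] E}
    (hY0 : Y 0 = ContinuousLinearMap.id ℝ E)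
    (hY : ∀ t ∈ Icc 0 S, HasDerivWithinAt Y ((fderiv ℝ g (γ t)).comp (Y t)) (Icc 0 S) t) :
    ∀ t ∈ Icc 0 S, Y t (g (γ 0)) = g (γ t) := by
  intro t ht
  have hw : ∀ s ∈ Icc 0 S, HasDerivWithinAt (fun s => Y s (g (γ 0)) - g (γ s))
      (fderiv ℝ g (γ s) (Y s (g (γ 0)) - g (γ s))) (Icc 0 S) s := fun s hs =>
    (((hY s hs).clm_apply (hasDerivWithinAt_const s _ (g (γ 0)))).sub
      ((hd (γ s)).hasFDerivAt.comp_hasDerivWithinAt s (hγ s hs))).congr_deriv (by simp)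
  refine sub_eq_zero.1 (eq_zero_of_abs_deriv_le_mul_abs_self_of_eq_zero_right (K := K)
    (fun s hs => (hw s hs).continuousWithinAt)
    (fun s hs => (hw s ⟨hs.1, hs.2.le⟩).mono_of_mem_nhdsWithin (Icc_mem_nhdsGE_of_mem hs))
    (by simp [hY0]) (fun s _ => ?_) t ht)
  refine (ContinuousLinearMap.le_opNorm _ _).trans ?_
  gcongr
  exact norm_fderiv_le_of_lipschitz ℝ hg

/-! ### Expansion of the flow along an orbit -/

/-- A `C²` vector field can be changed outside a ball into one that is bounded and globally
Lipschitz, with globally Lipschitz derivative. -/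
theorem exists_eq_on_closedBall_lipschitzWith {E : Type*} [NormedAddCommGroup E] [NormedSpace ℝ E]
    [FiniteDimensional ℝ E] {f : E → E} (hf : ContDiff ℝ 2 f) (R : ℝ) :
    ∃ g : E → E, ∃ K K' B : ℝ≥0, EqOn g f (Metric.closedBall 0 R) ∧ Differentiable ℝ g ∧
      LipschitzWith K g ∧ LipschitzWith K' (fderiv ℝ g) ∧ ∀ x, ‖g x‖ ≤ B := by
  let χ : ContDiffBump (0 : E) := ⟨max R 1, max R 1 + 1, by positivity, by linarith⟩
  have hg : ContDiff ℝ 2 (fun x => χ x • f x) := χ.contDiff.smul hf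
  have hgs : HasCompactSupport (fun x => χ x • f x) := χ.hasCompactSupport.smul_right
  obtain ⟨K, hK⟩ := hg.lipschitzWith_of_hasCompactSupport hgs (by simp)
  obtain ⟨K', hK'⟩ := (hg.fderiv_right (m := 1) (by norm_num)).lipschitzWith_of_hasCompactSupport
    (hgs.fderiv ℝ) (by simp)
  obtain ⟨B, hB⟩ := hgs.exists_bound_of_continuous hg.continuous
  refine ⟨_, K, K', B.toNNReal, fun x hx => ?_, hg.differentiable (by simp), hK, hK',
    fun x => (hB x).trans (Real.le_coe_toNNReal B)⟩
  have : χ x = 1 := χ.one_of_mem_closedBall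
    (Metric.closedBall_subset_closedBall (le_max_left _ _) hx)
  simp [this]

theorem localFlow_zero {E : Type*} [NormedAddCommGroup E] [NormedSpace ℝ E] {f : E → E}
    (hf : ContDiff ℝ 1 f) (x : E) : localFlow f 0 x = x := by
  have h : IsIntegralCurveOn (fun _ => x) (fun _ => f) (uIcc 0 0) := fun t ht => by
    rw [uIcc_self, mem_singleton_iff] at ht
    subst ht
    rw [uIcc_self]
    -- within the one-point interval every vector is a derivative
    refine hasDerivWithinAt_iff_hasFDerivWithinAt.2 (.of_not_accPt ?_)
    rw [accPt_iff_clusterPt, inf_principal]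
    simp [ClusterPt]
  exact localFlow_eq hf h

/-- Near the orbit of `x₀` the local flow is defined a little beyond time `T`, depends on the
initial value in a Lipschitz way, and has a second-order expansion at `(T, x₀)`. Its spatial
derivative `M` maps the velocity at `x₀` to the velocity at `φ(T, x₀)`. -/
theorem exists_localFlow_expansion {E : Type*} [NormedAddCommGroup E] [NormedSpace ℝ E]
    [FiniteDimensional ℝ E] {f : E → E} (hf : ContDiff ℝ 2 f) {x₀ : E} {T : ℝ} (hT : 0 < T)
    (hdom : (T, x₀) ∈ flowDomain f) :
    ∃ S > T, ∃ C : ℝ, 0 ≤ C ∧ ∃ M : E →L[ℝ] E, M (f x₀) = f (localFlow f T x₀) ∧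
      ∀ᶠ x in 𝓝 x₀, IsIntegralCurveOn (fun t => localFlow f t x) (fun _ => f) (Icc 0 S) ∧
        ∀ t ∈ Icc 0 S, (t, x) ∈ flowDomain f ∧
          ‖localFlow f t x - localFlow f t x₀‖ ≤ C * ‖x - x₀‖ ∧
          ‖localFlow f t x - localFlow f T x₀ - (t - T) • f (localFlow f T x₀) - M (x - x₀)‖ ≤
            C * (‖x - x₀‖ ^ 2 + (t - T) ^ 2) := by
  have := FiniteDimensional.complete ℝ E
  have hf1 : ContDiff ℝ 1 f := hf.of_le (by norm_num)
  obtain ⟨γ, hγ0, hγ⟩ := hdom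
  simp only [uIcc_of_le hT.le] at hγ hγ0
  obtain ⟨R, hR⟩ := isCompact_Icc.exists_bound_of_continuousOn hγ.continuousOn
  obtain ⟨g, K, K', B, hgf, hgd, hgL, hgL', hgB⟩ :=
    exists_eq_on_closedBall_lipschitzWith hf (R + 2)
  have hS0 : 0 ≤ T + 1 := by linarith
  choose Φ hΦ0 hΦ using fun x : E =>
    exists_isIntegralCurveOn_of_lipschitzWith_of_bounded (v := fun _ => g) (S := T + 1) hS0
      (fun _ _ => hgL) (fun _ => continuousOn_const) (fun _ _ y => hgB y) x
  have right : ∀ x, ∀ s ∈ Ico 0 (T + 1), HasDerivWithinAt (Φ x) (g (Φ x s)) (Ici s) s :=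
    fun x s hs => (hΦ x s ⟨hs.1, hs.2.le⟩).mono_of_mem_nhdsWithin (Icc_mem_nhdsGE_of_mem hs)
  set C₁ : ℝ := Real.exp (K * (T + 1)) with hC₁
  -- Solutions of the truncated equation depend on the initial value in a Lipschitz way.
  have hdist : ∀ x, ∀ s ∈ Icc 0 (T + 1), ‖Φ x s - Φ x₀ s‖ ≤ C₁ * ‖x - x₀‖ := fun x s hs => by
    have := dist_le_of_trajectories_ODE (v := fun _ => g) (fun _ => hgL) (hΦ x).continuousOn
      (right x) (hΦ x₀).continuousOn (right x₀) le_rfl s hs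
    rw [dist_eq_norm, dist_eq_norm, sub_zero, hΦ0, hΦ0, mul_comm] at this
    refine this.trans ?_
    rw [hC₁]
    gcongr
    exact hs.2
  have hΦγ : EqOn (Φ x₀) γ (Icc 0 T) := by
    refine ODE_solution_unique (v := fun _ => g) (K := K) (fun _ => hgL)
      ((hΦ x₀).continuousOn.mono (Icc_subset_Icc_right (by linarith)))
      (fun s hs => right x₀ s ⟨hs.1, by linarith [hs.2]⟩) hγ.continuousOn (fun s hs => ?_)
      ((hΦ0 x₀).trans hγ0.symm)
    have hs' : s ∈ Icc 0 T := ⟨hs.1, hs.2.le⟩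
    rw [hgf (by simpa using (hR s hs').trans (by linarith))]
    exact (hγ s hs').mono_of_mem_nhdsWithin (Icc_mem_nhdsGE_of_mem hs)
  -- The orbit of `x₀` stays in the ball for a while after time `T`.
  obtain ⟨S, hTS, hS1, hS⟩ : ∃ S > T, S ≤ T + 1 ∧ ∀ t ∈ Icc 0 S, ‖Φ x₀ t‖ ≤ R + 1 := by
    have hT' : ‖Φ x₀ T‖ < R + 1 := by
      rw [hΦγ (right_mem_Icc.2 hT.le)]
      linarith [hR T (right_mem_Icc.2 hT.le)]
    have h1 : ContinuousAt (Φ x₀) T := (hΦ x₀).continuousOn.continuousAt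
      (Icc_mem_nhds hT (by linarith))
    obtain ⟨ε, hε, hball⟩ := Metric.eventually_nhds_iff.1 (h1.norm.eventually_lt_const hT')
    refine ⟨T + min (ε / 2) 1, by simp [hε], by simp, fun t ht => ?_⟩
    rcases le_total t T with h | h
    · rw [hΦγ ⟨ht.1, h⟩]; linarith [hR t ⟨ht.1, h⟩]
    · refine (hball ?_).le
      rw [Real.dist_eq, abs_of_nonneg (by linarith)]
      linarith [ht.2, min_le_left (ε / 2) 1]
  have hsub : Icc 0 S ⊆ Icc 0 (T + 1) := Icc_subset_Icc_right hS1
  have hTmem : T ∈ Icc 0 S := ⟨hT.le, hTS.le⟩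
  have hnear : ∀ᶠ x in 𝓝 x₀, ∀ t ∈ Icc 0 S, Φ x t ∈ Metric.closedBall 0 (R + 2) := by
    have : Tendsto (fun x => C₁ * ‖x - x₀‖) (𝓝 x₀) (𝓝 0) := by
      have : Continuous fun x => C₁ * ‖x - x₀‖ := by fun_prop
      simpa using this.tendsto x₀
    filter_upwards [this.eventually_lt_const one_pos] with x hx t ht
    have h1 := hdist x t (hsub ht)
    have h2 := norm_le_norm_add_norm_sub' (Φ x t) (Φ x₀ t)
    have h3 := hS t ht
    simp only [mem_closedBall_zero_iff]
    linarith
  have hcurve : ∀ x, (∀ t ∈ Icc 0 S, Φ x t ∈ Metric.closedBall 0 (R + 2)) →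
      IsIntegralCurveOn (Φ x) (fun _ => f) (Icc 0 S) := fun x hx t ht => by
    change HasDerivWithinAt (Φ x) (f (Φ x t)) _ _
    rw [← hgf (hx t ht)]
    exact (hΦ x t (hsub ht)).mono hsub
  have hflow : ∀ x, (∀ t ∈ Icc 0 S, Φ x t ∈ Metric.closedBall 0 (R + 2)) →
      ∀ t ∈ Icc 0 S, (t, x) ∈ flowDomain f ∧ localFlow f t x = Φ x t := fun x hx t ht => by
    have h1 : IsIntegralCurveOn (Φ x) (fun _ => f) (uIcc 0 t) := by
      rw [uIcc_of_le ht.1]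
      exact (hcurve x hx).mono (Icc_subset_Icc_right ht.2)
    refine ⟨⟨Φ x, hΦ0 x, h1⟩, ?_⟩
    have := localFlow_eq hf1 h1
    rwa [hΦ0] at this
  have hflow₀ := hflow x₀ hnear.self_of_nhds
  have hfg : ∀ t ∈ Icc 0 S, f (Φ x₀ t) = g (Φ x₀ t) := fun t ht =>
    (hgf (hnear.self_of_nhds t ht)).symm
  obtain ⟨Y, hY0, hY⟩ := exists_fundamental_solution (A := fun t => fderiv ℝ g (Φ x₀ t)) hS0
    (hgL'.continuous.comp_continuousOn (hΦ x₀).continuousOn)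
  obtain ⟨C₂, hC₂0, hC₂⟩ : ∃ C₂ : ℝ, 0 ≤ C₂ ∧ ∀ x,
      ‖Φ x T - Φ x₀ T - Y T (x - x₀)‖ ≤ C₂ * ‖x - x₀‖ ^ 2 := by
    refine ⟨max (gronwallBound 0 K (K' * Real.exp (K * (T + 1)) ^ 2) (T + 1)) 0,
      le_max_right _ _, fun x => ?_⟩
    have := norm_sub_sub_fundamental_solution_le hgL hgd hgL' (hΦ x₀) (hΦ x) hY0 hY T
      (hsub hTmem)
    rw [hΦ0, hΦ0] at this
    refine this.trans ?_
    gcongr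
    exact le_max_left _ _
  -- The velocity along a nearby orbit, at a time close to `T`, is close to `g (Φ x₀ T)`.
  have htime : ∀ x, ∀ t ∈ Icc 0 S, ‖Φ x t - Φ x T - (t - T) • g (Φ x₀ T)‖ ≤
      K * (C₁ + B) * (‖x - x₀‖ ^ 2 + (t - T) ^ 2) := fun x t ht => by
    have hsub' : uIcc T t ⊆ Icc 0 (T + 1) := (uIcc_subset_Icc hTmem ht).trans hsub
    have hv : ∀ s ∈ uIcc T t, ‖g (Φ x s) - g (Φ x₀ T)‖ ≤
        K * (C₁ * ‖x - x₀‖ + B * |t - T|) := fun s hs => by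
      refine (hgL.norm_sub_le _ _).trans ?_
      gcongr
      have h1 := hdist x s (hsub' hs)
      have h2 : ‖Φ x₀ s - Φ x₀ T‖ ≤ B * ‖s - T‖ :=
        (convex_Icc 0 (T + 1)).norm_image_sub_le_of_norm_hasDerivWithin_le (hΦ x₀)
          (fun _ _ => hgB _) (hsub hTmem) (hsub' hs)
      have h3 : ‖s - T‖ ≤ |t - T| := abs_sub_left_of_mem_uIcc hs
      calc ‖Φ x s - Φ x₀ T‖ ≤ ‖Φ x s - Φ x₀ s‖ + ‖Φ x₀ s - Φ x₀ T‖ :=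
            norm_sub_le_norm_sub_add_norm_sub _ _ _
        _ ≤ C₁ * ‖x - x₀‖ + B * |t - T| :=
          add_le_add h1 (h2.trans (mul_le_mul_of_nonneg_left h3 B.coe_nonneg))
    have := (convex_uIcc T t).norm_image_sub_le_of_norm_hasDerivWithin_le
      (f := fun s => Φ x s - s • g (Φ x₀ T)) (f' := fun s => g (Φ x s) - g (Φ x₀ T))
      (fun s hs => ((hΦ x s (hsub' hs)).mono hsub').sub
        (((hasDerivWithinAt_id s _).smul_const (g (Φ x₀ T))).congr_deriv (one_smul _ _)))
      hv left_mem_uIcc right_mem_uIcc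
    have e : Φ x t - Φ x T - (t - T) • g (Φ x₀ T) =
        (Φ x t - t • g (Φ x₀ T)) - (Φ x T - T • g (Φ x₀ T)) := by rw [sub_smul]; abel
    rw [e]
    refine this.trans ?_
    rw [Real.norm_eq_abs, ← sq_abs (t - T)]
    have hK0 : (0 : ℝ) ≤ K := K.coe_nonneg
    have hB0 : (0 : ℝ) ≤ B := B.coe_nonneg
    have hC₁0 : 0 ≤ C₁ := (Real.exp_pos _).le
    have h4 : C₁ * (‖x - x₀‖ * |t - T|) ≤ C₁ * (‖x - x₀‖ ^ 2 + |t - T| ^ 2) := by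
      gcongr; nlinarith [sq_nonneg (‖x - x₀‖ - |t - T|), sq_nonneg ‖x - x₀‖, sq_nonneg |t - T|]
    have h5 : 0 ≤ B * ‖x - x₀‖ ^ 2 := by positivity
    calc _ = K * (C₁ * (‖x - x₀‖ * |t - T|) + B * |t - T| ^ 2) := by ring
      _ ≤ K * (C₁ * (‖x - x₀‖ ^ 2 + |t - T| ^ 2) + B * (‖x - x₀‖ ^ 2 + |t - T| ^ 2)) := by
        gcongr; exact le_add_of_nonneg_left (sq_nonneg _)
      _ = _ := by ring
  refine ⟨S, hTS, C₁ + K * (C₁ + B) + C₂, by positivity, Y T, ?_, ?_⟩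
  · have := fundamental_solution_apply_eq hgL hgd (hΦ x₀) hY0 hY T (hsub hTmem)
    rw [(hflow₀ T hTmem).2, hfg T hTmem, ← this]
    have h0 := hfg 0 ⟨le_rfl, hT.le.trans hTS.le⟩
    rw [hΦ0] at h0 ⊢
    rw [h0]
  · filter_upwards [hnear] with x hx
    refine ⟨fun t ht => ?_, fun t ht => ⟨(hflow x hx t ht).1, ?_, ?_⟩⟩
    · have h := hcurve x hx t ht
      rw [← (hflow x hx t ht).2] at h
      exact h.congr (fun s hs => (hflow x hx s hs).2) (hflow x hx t ht).2
    · rw [(hflow x hx t ht).2, (hflow₀ t ht).2]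
      refine (hdist x t (hsub ht)).trans ?_
      gcongr
      rw [add_assoc]
      exact le_add_of_nonneg_right (by positivity)
    · rw [(hflow x hx t ht).2, (hflow₀ T hTmem).2, hfg T hTmem]
      have e : Φ x t - Φ x₀ T - (t - T) • g (Φ x₀ T) - Y T (x - x₀) =
          (Φ x t - Φ x T - (t - T) • g (Φ x₀ T)) + (Φ x T - Φ x₀ T - Y T (x - x₀)) := by abel
      rw [e]
      refine (norm_add_le_of_le (htime x t ht) (hC₂ x)).trans ?_
      have h1 : 0 ≤ C₁ * (‖x - x₀‖ ^ 2 + (t - T) ^ 2) := by positivity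
      have h2 : 0 ≤ C₂ * (t - T) ^ 2 := by positivity
      linarith

/-! ### The tangent space of the section -/

/-- At a regular point the velocities of smooth curves in the level set fill the kernel of the
derivative: a local inverse of a map that straightens the level set carries line segments to curves
in the level set. -/
theorem tangentVectors_levelSet {E : Type*} [NormedAddCommGroup E] [NormedSpace ℝ E]
    [CompleteSpace E] {α : E → ℝ} {x₀ w : E} (hα : ContDiff ℝ ∞ α) (hx₀ : α x₀ = 0)
    (hw : fderiv ℝ α x₀ w ≠ 0) :
    tangentVectors (levelSet α) x₀ = {v | fderiv ℝ α x₀ v = 0} := by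
  set a := fderiv ℝ α x₀ with ha
  have hαd : HasFDerivAt α a x₀ := (hα.differentiable (by simp) x₀).hasFDerivAt
  ext v
  constructor
  · rintro ⟨γ, hγ0, hγ, hγs, rfl⟩
    have h1 : HasDerivAt γ (deriv γ 0) 0 := (hγs.differentiableAt (by simp)).hasDerivAt
    rw [← hγ0] at hαd
    have h2 := hαd.comp_hasDerivAt 0 h1
    have h3 : α ∘ γ =ᶠ[𝓝 0] fun _ => 0 := hγ
    exact (h2.congr_of_eventuallyEq h3.symm).unique (hasDerivAt_const (0 : ℝ) (0 : ℝ))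
  · intro hv
    -- `Ψ` straightens the level set: `a (Ψ x - x₀) = α x`, and its derivative at `x₀` is `id`.
    let Ψ : E → E := fun x => x + ((a w)⁻¹ * (α x - a (x - x₀))) • w
    have hΨ : ContDiff ℝ ∞ Ψ :=
      contDiff_id.add ((contDiff_const.mul
        (hα.sub (a.contDiff.comp (contDiff_id.sub contDiff_const)))).smul contDiff_const)
    have hΨa : ∀ x, a (Ψ x - x₀) = α x := fun x => by
      simp only [Ψ, add_sub_right_comm, map_add, map_smul, smul_eq_mul]
      field_simp
      ring
    have hΨ₀ : Ψ x₀ = x₀ := by simp [Ψ, hx₀]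
    have hΨd : HasFDerivAt Ψ ((ContinuousLinearEquiv.refl ℝ E : E ≃L[ℝ] E) : E →L[ℝ] E) x₀ := by
      have h1 : HasFDerivAt (fun x => a (x - x₀)) a x₀ :=
        a.hasFDerivAt.comp x₀ ((hasFDerivAt_id x₀).sub_const x₀)
      have h2 := (hasFDerivAt_id x₀).add
        (((hαd.sub h1).const_mul (a w)⁻¹).smul_const w)
      refine h2.congr_fderiv ?_
      ext y
      simp
    have hs : HasStrictFDerivAt Ψ ((ContinuousLinearEquiv.refl ℝ E : E ≃L[ℝ] E) : E →L[ℝ] E) x₀ :=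
      hΨ.contDiffAt.hasStrictFDerivAt' hΨd (by simp)
    set G := hΨ.contDiffAt.localInverse hΨd (by simp) with hG
    have hGs : ContDiffAt ℝ ∞ G x₀ := by
      have := hΨ.contDiffAt.to_localInverse hΨd (by simp)
      rwa [hΨ₀] at this
    have hGd : HasFDerivAt G (ContinuousLinearMap.id ℝ E) x₀ := by
      have := hs.to_localInverse.hasFDerivAt
      rw [hΨ₀] at this
      exact this
    have hGr : ∀ᶠ y in 𝓝 x₀, Ψ (G y) = y := by
      have := hs.eventually_right_inverse
      rwa [hΨ₀] at this
    have hG₀ : G x₀ = x₀ := by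
      have := hs.localInverse_apply_image
      rwa [hΨ₀] at this
    have hl : HasDerivAt (fun s : ℝ => x₀ + s • v) v 0 := by
      simpa using ((hasDerivAt_id (0 : ℝ)).smul_const v).const_add x₀
    have hl0 : x₀ + (0 : ℝ) • v = x₀ := by simp
    refine ⟨fun s => G (x₀ + s • v), by simp [hG₀], ?_, ?_, ?_⟩
    · have ht : Tendsto (fun s : ℝ => x₀ + s • v) (𝓝 0) (𝓝 x₀) := by
        simpa using hl.continuousAt.tendsto
      filter_upwards [ht.eventually hGr] with s hs
      change α _ = 0
      rw [← hΨa, hs]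
      simp only [add_sub_cancel_left, map_smul, smul_eq_mul]
      rw [show a v = 0 from hv, mul_zero]
    · refine ContDiffAt.comp (0 : ℝ) (by rwa [hl0]) ?_
      exact contDiffAt_const.add (contDiffAt_id.smul contDiffAt_const)
    · rw [← hl0] at hGd
      exact (hGd.comp_hasDerivAt (0 : ℝ) hl).deriv

/-! ### Expansion of the return time -/

/-- If `c η + N` vanishes to second order in `(d, η)` and `N = O(d)`, then `η = O(d)`, so that
`c η + N` vanishes to second order in `d` alone. -/
theorem isBigO_sq_of_isBigO_sq_add_sq {X : Type*} {l : Filter X} {η N d : X → ℝ} {c : ℝ}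
    (hc : c ≠ 0) (h : (fun x => c * η x + N x) =O[l] fun x => d x ^ 2 + η x ^ 2)
    (hN : N =O[l] d) (hη : Tendsto η l (𝓝 0)) (hd : Tendsto d l (𝓝 0)) :
    (fun x => c * η x + N x) =O[l] fun x => d x ^ 2 := by
  obtain ⟨C, hC, hb⟩ := h.exists_pos
  obtain ⟨k, hk, hNb⟩ := hN.exists_pos
  have hc' : 0 < |c| := abs_pos.2 hc
  have hη' : ∀ᶠ x in l, |η x| < |c| / (2 * C) := by
    have := hη.abs
    rw [abs_zero] at this
    exact this.eventually_lt_const (by positivity)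
  have hd' : ∀ᶠ x in l, |d x| < 1 := by
    have := hd.abs
    rw [abs_zero] at this
    exact this.eventually_lt_const one_pos
  refine IsBigO.of_bound (C * (1 + (2 * (C + k) / |c|) ^ 2)) ?_
  filter_upwards [hb.bound, hNb.bound, hη', hd'] with x h1 h2 h3 h4
  rw [Real.norm_of_nonneg (by positivity : 0 ≤ d x ^ 2 + η x ^ 2), Real.norm_eq_abs] at h1
  rw [Real.norm_eq_abs, Real.norm_eq_abs] at h2
  rw [Real.norm_of_nonneg (by positivity : 0 ≤ d x ^ 2), Real.norm_eq_abs]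
  rw [lt_div_iff₀ (by positivity)] at h3
  rw [← sq_abs (d x), ← sq_abs (η x)] at h1
  rw [← sq_abs (d x)]
  have h5 : |c| * |η x| ≤ |c * η x + N x| + |N x| := by
    rw [← abs_mul]
    simpa using abs_sub (c * η x + N x) (N x)
  -- The term `C * η²` is absorbed into the left-hand side, since `C * |η| ≤ |c| / 2`.
  have h6 : |η x| ≤ 2 * (C + k) / |c| * |d x| := by
    rw [div_mul_eq_mul_div, le_div_iff₀ hc']
    nlinarith [abs_nonneg (η x), abs_nonneg (d x),
      mul_le_mul_of_nonneg_left h4.le (abs_nonneg (d x)),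
      mul_le_mul_of_nonneg_left h3.le (abs_nonneg (η x)),
      mul_le_mul_of_nonneg_left (mul_le_mul_of_nonneg_left h4.le (abs_nonneg (d x))) hC.le]
  calc _ ≤ _ := h1
    _ ≤ C * (|d x| ^ 2 + (2 * (C + k) / |c| * |d x|) ^ 2) := by gcongr
    _ = _ := by ring

/-- Second-order expansion of `α(φ(t, x))` at a point `(T, x₀)` with `φ(T, x₀) = x₀`. -/
theorem isBigO_comp_localFlow {E : Type*} [NormedAddCommGroup E] [NormedSpace ℝ E]
    {f : E → E} {α : E → ℝ} (hα : ContDiff ℝ 2 α) {x₀ : E} {T S C : ℝ} (hT : 0 < T) (hTS : T < S)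
    {M : E →L[ℝ] E} (hper : localFlow f T x₀ = x₀)
    (hM : ∀ᶠ x in 𝓝 x₀, ∀ t ∈ Icc 0 S,
      ‖localFlow f t x - localFlow f T x₀ - (t - T) • f (localFlow f T x₀) - M (x - x₀)‖ ≤
        C * (‖x - x₀‖ ^ 2 + (t - T) ^ 2)) :
    (fun q : ℝ × E => α (localFlow f q.1 q.2) - α x₀ -
      (fderiv ℝ α x₀ (f x₀) * (q.1 - T) + fderiv ℝ α x₀ (M (q.2 - x₀)))) =O[𝓝 (T, x₀)]
      fun q => ‖q.2 - x₀‖ ^ 2 + (q.1 - T) ^ 2 := by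
  set D : ℝ × E → ℝ := fun q => ‖q.2 - x₀‖ ^ 2 + (q.1 - T) ^ 2 with hD
  have hDc : Continuous D := by fun_prop
  have hD0 : Tendsto D (𝓝 (T, x₀)) (𝓝 0) := by simpa [hD] using hDc.tendsto (T, x₀)
  rw [hper] at hM
  have h1 : (fun q : ℝ × E => localFlow f q.1 q.2 - x₀ - ((q.1 - T) • f x₀ + M (q.2 - x₀)))
      =O[𝓝 (T, x₀)] D := by
    refine IsBigO.of_bound C ?_
    have h2 : ∀ᶠ q : ℝ × E in 𝓝 (T, x₀), q.1 ∈ Icc 0 S :=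
      continuous_fst.tendsto (T, x₀) |>.eventually (Icc_mem_nhds hT hTS)
    filter_upwards [h2, continuous_snd.tendsto (T, x₀) |>.eventually hM] with q hq hqM
    rw [Real.norm_of_nonneg (by positivity : 0 ≤ D q), ← sub_sub]
    exact hqM q.1 hq
  have h2 : (fun q : ℝ × E => (q.1 - T) • f x₀ + M (q.2 - x₀)) =O[𝓝 (T, x₀)]
      fun q => q - (T, x₀) :=
    (((ContinuousLinearMap.fst ℝ ℝ E).smulRight (f x₀) +
      M.comp (ContinuousLinearMap.snd ℝ ℝ E)).isBigO_comp (fun q => q - (T, x₀)) _)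
  have h3 : (fun q : ℝ × E => ‖q - (T, x₀)‖ ^ 2) =O[𝓝 (T, x₀)] D := by
    refine IsBigO.of_bound 1 (Eventually.of_forall fun q => ?_)
    rw [Real.norm_of_nonneg (by positivity), Real.norm_of_nonneg (by positivity), one_mul,
      Prod.norm_def]
    simp only [hD, Prod.fst_sub, Prod.snd_sub]
    rcases max_choice ‖q.1 - T‖ ‖q.2 - x₀‖ with h | h <;> rw [h]
    · rw [Real.norm_eq_abs, sq_abs]; exact le_add_of_nonneg_left (sq_nonneg _)
    · exact le_add_of_nonneg_right (sq_nonneg _)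
  have h4 : D =O[𝓝 (T, x₀)] fun q : ℝ × E => q - (T, x₀) := by
    have h5 : DifferentiableAt ℝ (fun q : ℝ × E => (q.1 - T) ^ 2) (T, x₀) := by fun_prop
    have h6 : (fun q : ℝ × E => ‖q.2 - x₀‖ ^ 2) =O[𝓝 (T, x₀)] fun q : ℝ × E => q - (T, x₀) := by
      have h7 : (fun q : ℝ × E => ‖q.2 - x₀‖) =O[𝓝 (T, x₀)] fun q : ℝ × E => q - (T, x₀) :=
        (((ContinuousLinearMap.snd ℝ ℝ E).isBigO_comp (fun q => q - (T, x₀)) _)).norm_left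
      have h8 : Tendsto (fun q : ℝ × E => ‖q.2 - x₀‖) (𝓝 (T, x₀)) (𝓝 0) := by
        have : Continuous fun q : ℝ × E => ‖q.2 - x₀‖ := by fun_prop
        simpa using this.tendsto (T, x₀)
      simpa [sq] using (h8.isBigO_one ℝ).mul h7.norm_right
    have := h5.isBigO_sub
    simp only [sub_self, ne_eq, OfNat.ofNat_ne_zero, not_false_eq_true, zero_pow, sub_zero] at this
    exact h6.add this
  have h5 : (fun q : ℝ × E => localFlow f q.1 q.2 - x₀) =O[𝓝 (T, x₀)] fun q => q - (T, x₀) := by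
    refine ((h1.trans h4).add h2).congr_left fun q => ?_
    abel
  have h6 : Tendsto (fun q : ℝ × E => localFlow f q.1 q.2) (𝓝 (T, x₀)) (𝓝 x₀) := by
    have : Tendsto (fun q : ℝ × E => q - (T, x₀)) (𝓝 (T, x₀)) (𝓝 0) := by
      have : Continuous fun q : ℝ × E => q - (T, x₀) := by fun_prop
      simpa using this.tendsto (T, x₀)
    have := (h5.trans_tendsto this).add_const x₀
    simpa using this
  have h7 := ((isBigO_sub_sub_fderiv hα x₀).comp_tendsto h6).trans
    ((h5.norm_norm.pow 2).trans h3)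
  refine (h7.add (((fderiv ℝ α x₀).isBigO_comp _ _).trans h1)).congr_left fun q => ?_
  simp only [Function.comp_apply, map_sub, map_add, map_smul, smul_eq_mul]
  ring

/-! ### Existence of the return time -/

theorem strictMonoOn_comp_of_isIntegralCurveOn {E : Type*} [NormedAddCommGroup E] [NormedSpace ℝ E]
    {f : E → E} {α : E → ℝ} (hα : Differentiable ℝ α) {γ : ℝ → E} {a b : ℝ}
    (hγ : IsIntegralCurveOn γ (fun _ => f) (Icc a b))
    (hpos : ∀ t ∈ Icc a b, 0 < fderiv ℝ α (γ t) (f (γ t))) :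
    StrictMonoOn (fun t => α (γ t)) (Icc a b) := by
  have hd : ∀ t ∈ Icc a b,
      HasDerivWithinAt (fun t => α (γ t)) (fderiv ℝ α (γ t) (f (γ t))) (Icc a b) t :=
    fun t ht => (hα (γ t)).hasFDerivAt.comp_hasDerivWithinAt t (hγ t ht)
  refine strictMonoOn_of_deriv_pos (convex_Icc a b) (fun t ht => (hd t ht).continuousWithinAt)
    fun t ht => ?_
  rw [interior_Icc] at ht
  have ht' := Ioo_subset_Icc_self ht
  rw [((hd t ht').hasDerivAt (Icc_mem_nhds ht.1 ht.2)).deriv]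
  exact hpos t ht'

/-- Existence of the return time when the vector field crosses the section in the direction of
increasing `α`. -/
theorem exists_isReturnTime_of_pos {E : Type*} [NormedAddCommGroup E] [NormedSpace ℝ E]
    [FiniteDimensional ℝ E] {f : E → E} (hf : ContDiff ℝ 2 f) {x₀ : E} {T : ℝ}
    (hT : IsPeriodicPointWithMinimalPeriod f x₀ T) {α : E → ℝ} (hα : ContDiff ℝ 1 α)
    (hx₀ : α x₀ = 0) (hpos : 0 < fderiv ℝ α x₀ (f x₀)) :
    ∃ τ : E → ℝ, IsReturnTime f α x₀ τ := by
  obtain ⟨⟨hT0, hdom, hper⟩, hmin⟩ := hT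
  obtain ⟨S, hTS, C, hC, M, -, hflow⟩ := exists_localFlow_expansion hf hT0 hdom
  have hf1 : ContDiff ℝ 1 f := hf.of_le (by norm_num)
  have hαd : Differentiable ℝ α := hα.differentiable (by simp)
  have hTmem : T ∈ Icc 0 S := ⟨hT0.le, hTS.le⟩
  have hdist : ∀ ε > 0, ∀ᶠ x in 𝓝 x₀, ∀ t ∈ Icc 0 S,
      dist (localFlow f t x) (localFlow f t x₀) < ε := fun ε hε => by
    have h1 : Tendsto (fun x => C * ‖x - x₀‖) (𝓝 x₀) (𝓝 0) := by
      have : Continuous fun x => C * ‖x - x₀‖ := by fun_prop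
      simpa using this.tendsto x₀
    filter_upwards [h1.eventually_lt_const hε, hflow] with x hx hx' t ht
    rw [dist_eq_norm]
    exact (hx'.2 t ht).2.1.trans_lt hx
  have hc₀ : ContinuousOn (fun t => localFlow f t x₀) (Icc 0 S) :=
    hflow.self_of_nhds.1.continuousOn
  have hcT : ContinuousAt (fun t => localFlow f t x₀) T := hc₀.continuousAt (Icc_mem_nhds hT0 hTS)
  -- A ball in which the vector field crosses the level sets of `α` in the positive direction.
  obtain ⟨ρ, hρ, hρpos⟩ : ∃ ρ > 0, ∀ y ∈ Metric.ball x₀ ρ, 0 < fderiv ℝ α y (f y) := by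
    have : Continuous fun y => fderiv ℝ α y (f y) :=
      (hα.continuous_fderiv (by simp)).clm_apply hf.continuous
    exact Metric.eventually_nhds_iff_ball.1 (this.continuousAt.eventually_const_lt hpos)
  -- The orbit of `x₀` is well inside that ball for times close to `0` and to `T`.
  obtain ⟨δ, hδ, hδT, hδS, hδ0, hδ1⟩ : ∃ δ > 0, δ < T - δ ∧ T + δ ≤ S ∧
      (∀ t ∈ Icc 0 δ, dist (localFlow f t x₀) x₀ < ρ / 2) ∧
      ∀ t ∈ Icc (T - δ) (T + δ), dist (localFlow f t x₀) x₀ < ρ / 2 := by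
    have h0 : ∀ᶠ t in 𝓝[Icc 0 S] 0, dist (localFlow f t x₀) x₀ < ρ / 2 := by
      have := hc₀ 0 ⟨le_rfl, hT0.le.trans hTS.le⟩
      rw [ContinuousWithinAt, localFlow_zero hf1] at this
      exact this.eventually (Metric.ball_mem_nhds x₀ (half_pos hρ))
    have h1 : ∀ᶠ t in 𝓝 T, dist (localFlow f t x₀) x₀ < ρ / 2 := by
      rw [ContinuousAt, hper] at hcT
      exact hcT.eventually (Metric.ball_mem_nhds x₀ (half_pos hρ))
    obtain ⟨ε₀, hε₀, h0⟩ := Metric.eventually_nhds_iff.1 (eventually_nhdsWithin_iff.1 h0)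
    obtain ⟨ε₁, hε₁, h1⟩ := Metric.eventually_nhds_iff.1 h1
    obtain ⟨δ, hδ, hδlt⟩ := exists_between
      (show 0 < min (min ε₀ ε₁) (min (T / 2) (S - T)) by
        have : 0 < S - T := sub_pos.2 hTS
        positivity)
    simp only [lt_min_iff] at hδlt
    obtain ⟨⟨h2, h3⟩, h4, h5⟩ := hδlt
    refine ⟨δ, hδ, by linarith, by linarith, fun t ht => h0 ?_ ⟨ht.1, by linarith [ht.2]⟩,
      fun t ht => h1 ?_⟩
    · rw [Real.dist_eq, abs_lt]; constructor <;> linarith [ht.1, ht.2]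
    · rw [Real.dist_eq, abs_lt]; constructor <;> linarith [ht.1, ht.2]
  have hsub0 : Icc 0 δ ⊆ Icc 0 S := Icc_subset_Icc_right (by linarith)
  have hsub1 : Icc (T - δ) (T + δ) ⊆ Icc 0 S := Icc_subset_Icc (by linarith) hδS
  have hmono : ∀ᶠ x in 𝓝 x₀, StrictMonoOn (fun t => α (localFlow f t x)) (Icc 0 δ) ∧
      StrictMonoOn (fun t => α (localFlow f t x)) (Icc (T - δ) (T + δ)) := by
    filter_upwards [hflow, hdist (ρ / 2) (half_pos hρ)] with x hx hxd
    refine ⟨strictMonoOn_comp_of_isIntegralCurveOn hαd (hx.1.mono hsub0) fun t ht => hρpos _ ?_,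
      strictMonoOn_comp_of_isIntegralCurveOn hαd (hx.1.mono hsub1) fun t ht => hρpos _ ?_⟩
    · exact (dist_triangle _ _ _).trans_lt
        ((add_lt_add (hxd t (hsub0 ht)) (hδ0 t ht)).trans_eq (add_halves ρ))
    · exact (dist_triangle _ _ _).trans_lt
        ((add_lt_add (hxd t (hsub1 ht)) (hδ1 t ht)).trans_eq (add_halves ρ))
  -- Orbits of nearby points cross the section within any short time interval about `T`.
  have hroot : ∀ ε ∈ Ioc 0 δ, ∀ᶠ x in 𝓝 x₀, ∃ t ∈ Ioo (T - ε) (T + ε), α (localFlow f t x) = 0 := by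
    intro ε hε
    have hm := hmono.self_of_nhds.2
    have hTδ : T ∈ Icc (T - δ) (T + δ) := ⟨by linarith, by linarith⟩
    have hl : T - ε ∈ Icc (T - δ) (T + δ) := ⟨by linarith [hε.2], by linarith [hε.1]⟩
    have hr : T + ε ∈ Icc (T - δ) (T + δ) := ⟨by linarith [hε.1], by linarith [hε.2]⟩
    have hneg : α (localFlow f (T - ε) x₀) < 0 := by
      simpa [hper, hx₀] using hm hl hTδ (by linarith [hε.1])
    have hpos' : 0 < α (localFlow f (T + ε) x₀) := by
      simpa [hper, hx₀] using hm hTδ hr (by linarith [hε.1])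
    have hcont : ∀ t ∈ Icc 0 S, Tendsto (fun x => α (localFlow f t x)) (𝓝 x₀)
        (𝓝 (α (localFlow f t x₀))) := fun t ht =>
      (hα.continuous.tendsto _).comp <| Metric.tendsto_nhds.2 fun r hr =>
        (hdist r hr).mono fun x hx => hx t ht
    filter_upwards [hflow, (hcont _ (hsub1 hl)).eventually_lt_const hneg,
      (hcont _ (hsub1 hr)).eventually_const_lt hpos'] with x hx h1 h2
    obtain ⟨t, ht, h⟩ := intermediate_value_Ioo (f := fun t => α (localFlow f t x))
      (by linarith [hε.1] : T - ε ≤ T + ε)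
      (hα.continuous.comp_continuousOn (hx.1.continuousOn.mono
        ((Icc_subset_Icc hl.1 hr.2).trans hsub1))) ⟨h1, h2⟩
    exact ⟨t, ht, h⟩
  -- Between the times `δ` and `T - δ` the orbit of `x₀` keeps away from `x₀`.
  obtain ⟨r₀, hr₀, hr₀'⟩ : ∃ r₀, 0 < r₀ ∧
      ∀ t ∈ Icc δ (T - δ), r₀ ≤ dist (localFlow f t x₀) x₀ := by
    refine isCompact_Icc.exists_forall_le' ((continuous_id.dist continuous_const).comp_continuousOn
      (hc₀.mono (Icc_subset_Icc hδ.le (by linarith)))) fun t ht => dist_pos.2 fun h => ?_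
    have : T ≤ t := hmin ⟨hδ.trans_le ht.1,
      (hflow.self_of_nhds.2 t ⟨hδ.le.trans ht.1, by linarith [ht.2]⟩).1, h⟩
    linarith [ht.2]
  classical
  let τ : E → ℝ := fun x =>
    if h : ∃ t ∈ Icc (T - δ) (T + δ), α (localFlow f t x) = 0 then h.choose else T
  have hτ : ∀ᶠ x in 𝓝 x₀, τ x ∈ Icc (T - δ) (T + δ) ∧ α (localFlow f (τ x) x) = 0 := by
    filter_upwards [hroot δ ⟨hδ, le_rfl⟩] with x hx
    obtain ⟨t, ht, h⟩ := hx
    have h' : ∃ t ∈ Icc (T - δ) (T + δ), α (localFlow f t x) = 0 := ⟨t, Ioo_subset_Icc_self ht, h⟩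
    simp only [τ, dif_pos h']
    exact h'.choose_spec
  have huniq : ∀ᶠ x in 𝓝 x₀, ∀ t ∈ Icc (T - δ) (T + δ), α (localFlow f t x) = 0 → t = τ x := by
    filter_upwards [hτ, hmono] with x hx hm t ht h
    exact hm.2.injOn ht hx.1 (h.trans hx.2.symm)
  have hτ₀ : τ x₀ = T :=
    (huniq.self_of_nhds T ⟨by linarith, by linarith⟩ (by rw [hper, hx₀])).symm
  have hτc : ContinuousAt τ x₀ := by
    rw [ContinuousAt, hτ₀, Metric.tendsto_nhds]
    intro ε hε
    filter_upwards [hroot (min ε δ) ⟨lt_min hε hδ, min_le_right _ _⟩, huniq] with x hx hu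
    obtain ⟨t, ht, h⟩ := hx
    have h1 := min_le_left ε δ
    have h2 := min_le_right ε δ
    rw [← hu t ⟨by linarith [ht.1], by linarith [ht.2]⟩ h, Real.dist_eq, abs_lt]
    constructor <;> linarith [ht.1, ht.2]
  refine ⟨τ, hτc, ?_, ?_⟩
  · filter_upwards [hτ, hflow] with x hx hx'
    exact ⟨(hx'.2 _ (hsub1 hx.1)).1, hx.2⟩
  · have hr₁ : ∀ᶠ r in 𝓝[>] (0 : ℝ), r ∈ Ioo 0 (r₀ / 2) := Ioo_mem_nhdsGT (half_pos hr₀)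
    filter_upwards [hr₁] with r hr
    have hend : ∀ᶠ x in 𝓝 x₀, dist (localFlow f (τ x) x₀) x₀ < r / 2 := by
      rw [← hτ₀] at hcT
      have := ContinuousAt.comp hcT hτc
      rw [ContinuousAt, Function.comp_apply, hτ₀, hper] at this
      exact this.eventually (Metric.ball_mem_nhds x₀ (half_pos hr.1))
    filter_upwards [self_mem_nhdsWithin, hτ.filter_mono nhdsWithin_le_nhds,
      huniq.filter_mono nhdsWithin_le_nhds, hmono.filter_mono nhdsWithin_le_nhds,
      hflow.filter_mono nhdsWithin_le_nhds, hend.filter_mono nhdsWithin_le_nhds,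
      (hdist (r / 2) (half_pos hr.1)).filter_mono nhdsWithin_le_nhds]
      with x hxα hxτ hxu hxm hxf hxe hxd
    refine ⟨⟨by linarith [hxτ.1.1], (hxf.2 _ (hsub1 hxτ.1)).1, hxτ.2, ?_⟩, ?_⟩
    · exact (dist_triangle _ _ _).trans_lt
        ((add_lt_add (hxd _ (hsub1 hxτ.1)) hxe).trans_eq (add_halves r))
    · rintro t ⟨ht0, -, htα, htr⟩
      by_contra! hlt
      rcases le_total t δ with h1 | h1
      · -- `α` increases strictly along the orbit up to time `δ`, and vanishes at time `0`
        have h2 := hxm.1 ⟨le_rfl, hδ.le⟩ ⟨ht0.le, h1⟩ ht0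
        simp only [localFlow_zero hf1] at h2
        rw [show α x = 0 from hxα, show α (localFlow f t x) = 0 from htα] at h2
        exact h2.false
      · rcases le_total t (T - δ) with h2 | h2
        · have h3 := hr₀' t ⟨h1, h2⟩
          have h4 := hxd t ⟨ht0.le, by linarith⟩
          rw [Metric.mem_ball] at htr
          have h5 := dist_triangle_left (localFlow f t x₀) x₀ (localFlow f t x)
          linarith [hr.2]
        · exact hlt.ne (hxu t ⟨h2, by linarith [hxτ.1.2]⟩ htα)

theorem exists_isReturnTime {E : Type*} [NormedAddCommGroup E] [NormedSpace ℝ E]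
    [FiniteDimensional ℝ E] {f : E → E} (hf : ContDiff ℝ 2 f) {x₀ : E} {T : ℝ}
    (hT : IsPeriodicPointWithMinimalPeriod f x₀ T) {α : E → ℝ} (hα : ContDiff ℝ 1 α)
    (hx₀ : α x₀ = 0) (htr : fderiv ℝ α x₀ (f x₀) ≠ 0) :
    ∃ τ : E → ℝ, IsReturnTime f α x₀ τ := by
  rcases htr.lt_or_gt with h | h
  · have hneg : levelSet (fun x => -α x) = levelSet α := by ext; simp [levelSet]
    obtain ⟨τ, h1, h2, h3⟩ := exists_isReturnTime_of_pos hf hT hα.neg (by simp [hx₀])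
      (by rw [fderiv_fun_neg]; simpa using h)
    exact ⟨τ, h1, by rwa [hneg] at h2, by rwa [hneg] at h3⟩
  · exact exists_isReturnTime_of_pos hf hT hα hx₀ h

theorem IsReturnTime.apply_eq {E : Type*} [NormedAddCommGroup E] [NormedSpace ℝ E] {f : E → E}
    {x₀ : E} {T : ℝ} (hT : IsPeriodicPointWithMinimalPeriod f x₀ T) {α : E → ℝ} (hx₀ : α x₀ = 0)
    {τ : E → ℝ} (hτ : IsReturnTime f α x₀ τ) : τ x₀ = T := by
  obtain ⟨⟨hT0, hdom, hper⟩, hmin⟩ := hT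
  have h : ∀ᶠ r in 𝓝[>] (0 : ℝ), IsLeast {t : ℝ | 0 < t ∧ (t, x₀) ∈ flowDomain f ∧
      localFlow f t x₀ ∈ levelSet α ∩ Metric.ball x₀ r} (τ x₀) :=
    hτ.first_return.mono fun r hr => hr.self_of_nhdsWithin hx₀
  refine le_antisymm ?_ ?_
  · obtain ⟨r, hr, hr0⟩ := (h.and self_mem_nhdsWithin).exists
    refine hr.2 ⟨hT0, hdom, ?_⟩
    rw [hper]
    exact ⟨hx₀, Metric.mem_ball_self hr0⟩
  · obtain ⟨r, hr, -⟩ := (h.and self_mem_nhdsWithin).exists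
    -- the orbit is at distance `< r` from `x₀` at time `τ x₀`, for every small `r`
    refine hmin ⟨hr.1.1, hr.1.2.1, dist_le_zero.1 ?_⟩
    have h0 : Tendsto (fun r : ℝ => r) (𝓝[>] 0) (𝓝 0) := nhdsWithin_le_nhds
    exact ge_of_tendsto h0 (h.mono fun r hr => (Metric.mem_ball.1 hr.1.2.2.2).le)

/-! ### The return time and left eigenvectors of the monodromy -/

/-- If `M` fixes a vector outside `ker a`, then `a M` and `a` have the same kernel only if they are
equal. -/
theorem ker_comp_eq_ker_iff {E : Type*} [NormedAddCommGroup E] [NormedSpace ℝ E] {a : E →L[ℝ] ℝ}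
    {M : E →L[ℝ] E} {w : E} (hw : a w ≠ 0) (hM : M w = w) :
    {v | a (M v) = 0} = {v | a v = 0} ↔ IsLeftEigenvector M 1 a := by
  constructor
  · refine fun h => ⟨fun h0 => hw (by simp [h0]), ?_⟩
    ext v
    have h1 : v - (a v / a w) • w ∈ {v | a (M v) = 0} := by
      rw [h]
      simp [hw]
    simp only [mem_ofPred_eq, map_sub, map_smul, hM, smul_eq_mul, div_mul_cancel₀ _ hw] at h1
    simpa using sub_eq_zero.1 h1
  · rintro ⟨-, h⟩
    ext v
    have := DFunLike.congr_fun h v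
    simp only [ContinuousLinearMap.comp_apply, one_smul] at this
    simp [this]

theorem mainTheorem3 {n : ℕ}
    (f : EuclideanSpace ℝ (Fin n) → EuclideanSpace ℝ (Fin n)) (hf : ContDiff ℝ ∞ f)
    (x₀ : EuclideanSpace ℝ (Fin n)) (T : ℝ)
    (hT : IsPeriodicPointWithMinimalPeriod f x₀ T)
    (hM : IsSimpleEigenvalue (monodromy f x₀ T) 1)
    (α : EuclideanSpace ℝ (Fin n) → ℝ) (hα : IsLocalPoincareSection f α x₀) :
    (∃ τ : EuclideanSpace ℝ (Fin n) → ℝ, IsReturnTime f α x₀ τ) ∧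
    ∀ τ : EuclideanSpace ℝ (Fin n) → ℝ, IsReturnTime f α x₀ τ →
      τ x₀ = T ∧ DifferentiableAt ℝ τ x₀ ∧
      ({v | fderiv ℝ τ x₀ v = 0} = tangentVectors (levelSet α) x₀ ↔
        IsLeftEigenvector (monodromy f x₀ T) 1 (fderiv ℝ α x₀)) ∧
      (IsLeftEigenvector (monodromy f x₀ T) 1 (fderiv ℝ α x₀) →
        (fun x => τ x - τ x₀) =O[𝓝[levelSet α] x₀] fun x => ‖x - x₀‖ ^ 2) := by
  have hf2 : ContDiff ℝ 2 f := contDiff_infty.1 hf 2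
  have hα2 : ContDiff ℝ 2 α := contDiff_infty.1 hα.smooth 2
  have hx₀ : α x₀ = 0 := hα.mem
  have htr := hα.transversal
  refine ⟨exists_isReturnTime hf2 hT (hα2.of_le (by norm_num)) hx₀ htr, fun τ hτ => ?_⟩
  have hτT := hτ.apply_eq hT hx₀
  obtain ⟨⟨hT0, hdom, hper⟩, -⟩ := hT
  obtain ⟨S, hTS, C, -, M, hMf, hflow⟩ := exists_localFlow_expansion hf2 hT0 hdom
  have hexp := hflow.mono fun x hx t ht => (hx.2 t ht).2.2
  have hd0 : Tendsto (fun x => ‖x - x₀‖) (𝓝 x₀) (𝓝 0) := tendsto_norm_sub_self x₀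
  have hsq : (fun x => ‖x - x₀‖ ^ 2) =o[𝓝 x₀] fun x => x - x₀ := by
    have := ((isLittleO_one_iff ℝ).2 hd0).mul_isBigO (isBigO_refl (fun x => ‖x - x₀‖) (𝓝 x₀))
    simpa [sq] using this.norm_right
  have hmono : monodromy f x₀ T = M := by
    refine HasFDerivAt.fderiv (.of_isLittleO (IsBigO.trans_isLittleO (.of_bound C ?_) hsq))
    filter_upwards [hexp] with x hx
    simpa using hx T ⟨hT0.le, hTS.le⟩
  rw [hmono]
  rw [hper] at hMf
  set a := fderiv ℝ α x₀ with ha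
  have hτ0 : Tendsto (fun x => τ x - T) (𝓝 x₀) (𝓝 0) := by
    have := hτ.continuousAt.tendsto.sub_const T
    rwa [hτT, sub_self] at this
  -- The linear part of the equation `α (φ (τ x, x)) = 0` holds up to second order.
  have hlin : (fun x => a (f x₀) * (τ x - T) + a (M (x - x₀))) =O[𝓝 x₀]
      fun x => ‖x - x₀‖ ^ 2 := by
    refine isBigO_sq_of_isBigO_sq_add_sq htr ?_ ((a.comp M).isBigO_comp _ _).norm_right hτ0 hd0
    have hpair : Tendsto (fun x => (τ x, x)) (𝓝 x₀) (𝓝 (T, x₀)) := by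
      have := hτ.continuousAt.prodMk continuousAt_id
      rwa [ContinuousAt, hτT] at this
    refine ((isBigO_comp_localFlow hα2 hT0 hTS hper hexp).comp_tendsto hpair).neg_left.congr' ?_
      .rfl
    filter_upwards [hτ.mem_section] with x hx
    have : α (localFlow f (τ x) x) = 0 := hx.2
    simp [this, hx₀, ha]
  have hderiv : HasFDerivAt τ (-(a (f x₀))⁻¹ • a.comp M) x₀ := by
    refine .of_isLittleO
      (((hlin.const_mul_left (a (f x₀))⁻¹).congr_left fun x => ?_).trans_isLittleO hsq)
    simp only [hτT, smul_apply, ContinuousLinearMap.comp_apply, smul_eq_mul]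
    field_simp
    ring
  have hker : {v | fderiv ℝ τ x₀ v = 0} = {v | a (M v) = 0} := by
    ext v
    rw [hderiv.fderiv]
    simp [htr]
  refine ⟨hτT, hderiv.differentiableAt, ?_, fun hleft => ?_⟩
  · rw [hker, tangentVectors_levelSet hα.smooth hx₀ htr]
    exact ker_comp_eq_ker_iff htr hMf
  · have h1 : (fun x => a (x - x₀)) =O[𝓝[levelSet α] x₀] fun x => ‖x - x₀‖ ^ 2 := by
      refine ((isBigO_sub_sub_fderiv hα2 x₀).mono nhdsWithin_le_nhds).neg_left.congr' ?_ .rfl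
      filter_upwards [self_mem_nhdsWithin] with x hx
      have : α x = 0 := hx
      simp [this, hx₀, ha]
    refine (((hlin.mono nhdsWithin_le_nhds).sub h1).const_mul_left (a (f x₀))⁻¹).congr_left
      fun x => ?_
    have h2 : a (M (x - x₀)) = a (x - x₀) := by
      simpa using DFunLike.congr_fun hleft.2 (x - x₀)
    rw [h2, hτT]
    field_simp
    ring
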